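/- Let $n\ge 0$ be an integer and let $\mathfrak S_n$ be the symmetric group on $n$ letters. Let $\lambda\ge 1$ and let $\mathbb A^{(\lambda)}(\mathbb D^n)$ be the Hilbert space of functions on the open unit polydisc $\mathbb D^n\subset\mathbb C^n$ with reproducing kernel $$K^{(\lambda)}(z,w)=\prod_{j=1}^n(1-z_j\bar w_j)^{-\lambda}.$$ Let $\mathfrak S_n$ act on $\mathbb C^n$ by $\sigma\cdot z=(z_{\sigma^{-1}(1)},\dots,z_{\sigma^{-1}(n)})$. Let $p$ be a partition of $n$, let $\pi_p:\mathfrak S_n\to U(m)$ be any unitary matrix representation in the equivalence class of the irreducible representation of $\mathfrak S_n$ indexed by $p$ (the left ideal of $\mathbb C[\mathfrak S_n]$ generated by the Young symmetrizer of $p$), where $m=\chi_p(1)$ is its dimension, and for $1\le i\le m$ define on $\mathbb A^{(\lambda)}(\mathbb D^n)$ $$(\mathbb P_p^{ii}f)(z)=\frac{m}{n!}\sum_{\sigma\in\mathfrak S_n}\pi_p^{ii}(\sigma^{-1})\,f(\sigma^{-1}\cdot z).$$ Let $s_k(z)=\sum_{1\le j_1<\dots<j_k\le n}z_{j_1}\cdots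 z_{j_k}$ for $1\le k\le n$, let $\boldsymbol s=(s_1,\dots,s_n):\mathbb C^n\to\mathbb C^n$, and let $\Gamma_n$ be the closure of $\boldsymbol s(\mathbb D^n)$. Then multiplication by each $s_k$ defines a bounded operator $M_{s_k}$ on $\mathbb A^{(\lambda)}(\mathbb D^n)$ that leaves the subspace $\mathbb P_p^{ii}\big(\mathbb A^{(\lambda)}(\mathbb D^n)\big)$ invariant, and the tuple $T=(T_1,\dots,T_n)$ of the restrictions of $M_{s_1},\dots,M_{s_n}$ to this subspace is a $\Gamma_n$-contraction; that is, the operators $T_k$ commute and $\Gamma_n$ is a spectral set for $T$ in the sense that $$\|q(T_1,\dots,T_n)\|\le\sup_{u\in\Gamma_n}|q(u)|\qquad\text{for every polynomial } q\in\mathbb C[u_1,\dots,u_n].$$ -/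

import Mathlib

noncomputable section

namespace SymBergman

open scoped ComplexConjugate ComplexOrder

/-! ### The weighted Bergman space of the polydisc -/

/-- The open unit polydisc in `ℂⁿ`. -/
def Polydisc (n : ℕ) : Type := {z : Fin n → ℂ // ∀ i, ‖z i‖ < 1}

/-- The point with coordinates `z (σ 0), …, z (σ (n-1))`, which is `σ⁻¹ · z` for the left action
`σ · z = (z (σ⁻¹ 0), …, z (σ⁻¹ (n-1)))` of the symmetric group. -/
def Polydisc.invPerm {n : ℕ} (σ : Equiv.Perm (Fin n)) (z : Polydisc n) : Polydisc n :=
  ⟨fun i => z.1 (σ i), fun i => z.2 (σ i)⟩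

/-- `K(z, w) = ∏ⱼ (1 - zⱼ w̄ⱼ)^(-λ)`; the base has positive real part and the power is the
principal one. -/
def kernelFun (n : ℕ) (lam : ℝ) : Matrix (Polydisc n) (Polydisc n) ℂ :=
  Matrix.of fun z w => ∏ j, (1 - z.1 j * conj (w.1 j)) ^ (-(lam : ℂ))

/-- The same kernel, a complex number being read as an operator on `ℂ`. -/
def kernelOp (n : ℕ) (lam : ℝ) : Matrix (Polydisc n) (Polydisc n) (ℂ →L[ℂ] ℂ) :=
  Matrix.of fun z w => kernelFun n lam z w • ContinuousLinearMap.id ℂ ℂ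

theorem choose_nonneg {lam : ℝ} (h : 0 < lam) (k : ℕ) :
    (0 : ℂ) ≤ Ring.choose ((lam : ℂ) + k - 1) k := by
  have h1 := Ring.factorial_nsmul_multichoose_eq_ascPochhammer (lam : ℂ) k
  rw [Ring.multichoose_eq, Polynomial.ascPochhammer_smeval_eq_eval, nsmul_eq_mul] at h1
  have h2 : (ascPochhammer ℂ k).eval (lam : ℂ) = ((ascPochhammer ℝ k).eval lam : ℝ) := by
    rw [← ascPochhammer_map Complex.ofRealHom, Polynomial.eval_map]
    exact Polynomial.eval₂_at_apply Complex.ofRealHom lam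
  have h3 : Ring.choose ((lam : ℂ) + k - 1) k
      = (((ascPochhammer ℝ k).eval lam / (k.factorial : ℝ) : ℝ) : ℂ) := by
    push_cast
    rw [eq_div_iff (by exact_mod_cast k.factorial_ne_zero), mul_comm, h1, h2]
  rw [h3]
  exact_mod_cast div_nonneg (ascPochhammer_pos k lam h).le (by positivity)

theorem disc_hasSum (lam : ℝ) {x : ℂ} (hx : ‖x‖ < 1) :
    HasSum (fun k : ℕ => Ring.choose ((lam : ℂ) + k - 1) k * x ^ k)
      ((1 - x) ^ (-(lam : ℂ))) := by
  have h := (Complex.one_div_one_sub_cpow_hasFPowerSeriesOnBall_zero (lam : ℂ)).hasSum_sub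
    (y := x) (by
      rw [← ENNReal.ofReal_one, Metric.eball_ofReal]
      simpa using hx)
  simpa [FormalMultilinearSeries.ofScalars, Complex.cpow_neg, List.prod_ofFn] using h

theorem norm_mul_conj_lt {z w : ℂ} (hz : ‖z‖ < 1) (hw : ‖w‖ < 1) : ‖z * conj w‖ < 1 := by
  rw [norm_mul, RCLike.norm_conj]
  nlinarith [norm_nonneg z, norm_nonneg w]

theorem posSemidef_of_hasSum {X : Type*} {A : ℕ → Matrix X X ℂ} {B : Matrix X X ℂ}
    (hA : ∀ k, (A k).PosSemidef) (h : ∀ x y, HasSum (fun k => A k x y) (B x y)) :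
    B.PosSemidef := by
  refine ⟨?_, fun v => ?_⟩
  · ext x y
    rw [Matrix.conjTranspose_apply]
    refine (h y x).star.unique ?_
    simpa only [← Matrix.conjTranspose_apply, (hA _).1.eq] using h x y
  · have hs : HasSum (fun k => v.sum fun i xi => v.sum fun j xj => star xi * A k i j * xj)
        (v.sum fun i xi => v.sum fun j xj => star xi * B i j * xj) :=
      hasSum_sum fun i _ => hasSum_sum fun j _ => ((h i j).mul_left _).mul_right _
    exact hs.nonneg fun k => (hA k).2 v

theorem rankOne_posSemidef {X : Type*} (φ : X → ℂ) :
    (Matrix.of fun x y => φ x * conj (φ y) : Matrix X X ℂ).PosSemidef := by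
  refine ⟨by ext; simp [mul_comm], fun v => ?_⟩
  have : (v.sum fun i xi => v.sum fun j xj => star xi * (φ i * conj (φ j)) * xj)
      = star (v.sum fun i xi => conj (φ i) * xi) * (v.sum fun i xi => conj (φ i) * xi) := by
    simp only [Finsupp.sum, star_sum, Finset.sum_mul_sum]
    refine Finset.sum_congr rfl fun i _ => Finset.sum_congr rfl fun j _ => ?_
    simp
    ring
  simp only [Matrix.of_apply]
  rw [this]
  exact star_mul_self_nonneg _

theorem disc_posSemidef {lam : ℝ} (h : 0 < lam) {X : Type*} (φ : X → ℂ) (hφ : ∀ x, ‖φ x‖ < 1) :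
    (Matrix.of fun z w => (1 - φ z * conj (φ w)) ^ (-(lam : ℂ)) : Matrix X X ℂ).PosSemidef := by
  refine posSemidef_of_hasSum
    (A := fun k => Ring.choose ((lam : ℂ) + k - 1) k •
      Matrix.of fun z w => φ z ^ k * conj (φ w ^ k))
    (fun k => (rankOne_posSemidef fun z => φ z ^ k).smul (choose_nonneg h k)) fun x y => ?_
  simpa [mul_pow] using disc_hasSum lam (norm_mul_conj_lt (hφ x) (hφ y))

theorem kernelFun_posSemidef (n : ℕ) {lam : ℝ} (h : 0 < lam) :
    (kernelFun n lam).PosSemidef := by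
  have key : ∀ s : Finset (Fin n), (Matrix.of fun z w : Polydisc n =>
      ∏ j ∈ s, (1 - z.1 j * conj (w.1 j)) ^ (-(lam : ℂ)) : Matrix _ _ ℂ).PosSemidef := by
    intro s
    induction s using Finset.induction_on with
    | empty => simpa using! rankOne_posSemidef fun _ : Polydisc n => 1
    | insert a s ha ih =>
      have := (disc_posSemidef h (fun z : Polydisc n => z.1 a) fun z => z.2 a).hadamard ih
      have e : (Matrix.of fun z w : Polydisc n =>
          ∏ j ∈ insert a s, (1 - z.1 j * conj (w.1 j)) ^ (-(lam : ℂ)) : Matrix _ _ ℂ)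
          = Matrix.hadamard (Matrix.of fun z w => (1 - z.1 a * conj (w.1 a)) ^ (-(lam : ℂ)))
            (Matrix.of fun z w => ∏ j ∈ s, (1 - z.1 j * conj (w.1 j)) ^ (-(lam : ℂ))) := by
        ext z w
        simp [Finset.prod_insert ha]
      rw [e]
      exact this
  exact key Finset.univ

theorem kernelOp_posSemidef (n : ℕ) {lam : ℝ} (h : 0 < lam) : (kernelOp n lam).PosSemidef := by
  have hK := kernelFun_posSemidef n h
  have H := RKHS.posSemidef_tfae (K := kernelOp n lam)
  refine (H.out 0 2).mpr (And.intro ?_ fun v => ?_)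
  · ext z w
    have := hK.1.apply z w
    simp only [RCLike.star_def] at this
    have e : ContinuousLinearMap.adjoint (ContinuousLinearMap.id ℂ ℂ)
        = ContinuousLinearMap.id ℂ ℂ := ContinuousLinearMap.adjoint_id
    simp [kernelOp, ContinuousLinearMap.star_eq_adjoint, ← this, e]
  · have h1 := (Complex.le_def.1 (hK.2 v)).1
    refine h1.trans_eq ((Complex.conj_re _).symm.trans (congrArg Complex.re ?_))
    simp only [Finsupp.sum, kernelOp, Matrix.of_apply, map_sum]
    rw [Finset.sum_comm]
    refine Finset.sum_congr rfl fun i _ => Finset.sum_congr rfl fun j _ => ?_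
    simp
    ring

instance instFact (n : ℕ) (lam : Set.Ioi (0 : ℝ)) : Fact (kernelOp n lam).PosSemidef :=
  ⟨kernelOp_posSemidef n lam.2⟩

/-- The weighted Bergman space: the Hilbert space of functions on the polydisc
with reproducing kernel `K`. -/
abbrev BergmanSpace (n : ℕ) (lam : Set.Ioi (0 : ℝ)) : Type :=
  RKHS.OfKernel (kernelOp n lam)

/-- The kernel function `K(·, w)` as an element of the Bergman space. -/
def ker {n : ℕ} (lam : Set.Ioi (0 : ℝ)) (w : Polydisc n) : BergmanSpace n lam :=
  RKHS.kerFun (BergmanSpace n lam) w 1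

theorem inner_ker {n : ℕ} {lam : Set.Ioi (0 : ℝ)} (w : Polydisc n) (f : BergmanSpace n lam) :
    inner ℂ (ker lam w) f = f w := by
  simp [ker]

theorem ker_apply {n : ℕ} {lam : Set.Ioi (0 : ℝ)} (z w : Polydisc n) :
    ker lam w z = kernelFun n lam z w := by
  rw [ker, RKHS.kerFun_apply, RKHS.OfKernel.kernel_ofKernel]
  simp [kernelOp]

/-- Finite linear combinations of kernel functions. -/
def kerComb {n : ℕ} (lam : Set.Ioi (0 : ℝ)) : (Polydisc n →₀ ℂ) →ₗ[ℂ] BergmanSpace n lam :=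
  Finsupp.linearCombination ℂ (ker lam)

theorem kerComb_dense {n : ℕ} (lam : Set.Ioi (0 : ℝ)) :
    DenseRange (kerComb (n := n) lam) := by
  have h := RKHS.kerFun_dense (BergmanSpace n lam)
  have h2 : Submodule.span ℂ {x | ∃ (w : Polydisc n) (v : ℂ),
      RKHS.kerFun (BergmanSpace n lam) w v = x} ≤ LinearMap.range (kerComb (n := n) lam) := by
    rw [Submodule.span_le]
    rintro _ ⟨w, v, rfl⟩
    refine ⟨Finsupp.single w v, ?_⟩
    rw [kerComb, Finsupp.linearCombination_single, ker, ← map_smul, smul_eq_mul, mul_one]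
  have h3 := Submodule.topologicalClosure_mono h2
  rw [h, top_le_iff] at h3
  rw [DenseRange, ← LinearMap.coe_range]
  exact (Submodule.dense_iff_topologicalClosure_eq_top).2 h3

theorem kernelFun_invPerm {n : ℕ} (lam : ℝ) (σ : Equiv.Perm (Fin n)) (z w : Polydisc n) :
    kernelFun n lam (z.invPerm σ) (w.invPerm σ) = kernelFun n lam z w :=
  Equiv.prod_comp σ fun j => (1 - z.1 j * conj (w.1 j)) ^ (-(lam : ℂ))

theorem norm_kerComb_invPerm {n : ℕ} (lam : Set.Ioi (0 : ℝ)) (σ : Equiv.Perm (Fin n))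
    (v : Polydisc n →₀ ℂ) :
    ‖kerComb lam (Finsupp.lmapDomain ℂ ℂ (Polydisc.invPerm σ) v)‖ = ‖kerComb lam v‖ := by
  have h1 : kerComb lam (Finsupp.lmapDomain ℂ ℂ (Polydisc.invPerm σ) v)
      = v.sum fun w c => c • ker lam (w.invPerm σ) := by
    rw [kerComb, Finsupp.lmapDomain_apply, Finsupp.linearCombination_mapDomain,
      Finsupp.linearCombination_apply]
    rfl
  have h2 : kerComb lam v = v.sum fun w c => c • ker lam w := rfl
  rw [← sq_eq_sq₀ (norm_nonneg _) (norm_nonneg _)]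
  rw [← inner_self_eq_norm_sq (𝕜 := ℂ), ← inner_self_eq_norm_sq (𝕜 := ℂ), h1, h2]
  simp only [Finsupp.sum, sum_inner, inner_sum, inner_smul_left, inner_smul_right,
    inner_ker, ker_apply, kernelFun_invPerm]

/-- The operator `R_σ f = f ∘ σ⁻¹`, built as the adjoint of the isometry that sends `K(·, w)` to
`K(·, σ⁻¹ · w)`. -/
def permOp {n : ℕ} (lam : Set.Ioi (0 : ℝ)) (σ : Equiv.Perm (Fin n)) :
    BergmanSpace n lam →L[ℂ] BergmanSpace n lam :=
  ((kerComb lam ∘ₗ Finsupp.lmapDomain ℂ ℂ (Polydisc.invPerm σ)).extendOfNorm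
    (kerComb lam)).adjoint

/-- `(R_σ f)(z) = f(σ⁻¹ · z)`. -/
theorem permOp_apply {n : ℕ} (lam : Set.Ioi (0 : ℝ)) (σ : Equiv.Perm (Fin n))
    (f : BergmanSpace n lam) (z : Polydisc n) : permOp lam σ f z = f (z.invPerm σ) := by
  rw [← inner_ker z, permOp, ContinuousLinearMap.adjoint_inner_right, ← inner_ker (z.invPerm σ)]
  congr 1
  have h := LinearMap.extendOfNorm_eq
    (f := kerComb lam ∘ₗ Finsupp.lmapDomain ℂ ℂ (Polydisc.invPerm σ)) (kerComb_dense lam)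
    ⟨1, fun v => by rw [one_mul]; exact (norm_kerComb_invPerm lam σ v).le⟩ (Finsupp.single z 1)
  simpa [kerComb] using h

/-! ### Irreducible representations of the symmetric group, indexed by partitions -/

/-- The box (row, column) of the number `k` when the boxes of the diagram with the given row lengths
are numbered `0, 1, 2, …` along the rows, from top to bottom. -/
def boxOf : List ℕ → ℕ → ℕ × ℕ
  | [], _ => (0, 0)
  | a :: L, k => if k < a then (0, k) else ((boxOf L (k - a)).1 + 1, (boxOf L (k - a)).2)

/-- The box of `k` in the canonical tableau of the Young diagram of the partition `p`. -/
def tableau {n : ℕ} (p : n.Partition) (k : Fin n) : ℕ × ℕ :=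
  boxOf (p.parts.sort (· ≥ ·)) k

/-- The permutations preserving each row of the tableau. -/
def rowGroup {n : ℕ} (p : n.Partition) : Set (Equiv.Perm (Fin n)) :=
  {σ | ∀ k, (tableau p (σ k)).1 = (tableau p k).1}

/-- The permutations preserving each column of the tableau. -/
def colGroup {n : ℕ} (p : n.Partition) : Set (Equiv.Perm (Fin n)) :=
  {σ | ∀ k, (tableau p (σ k)).2 = (tableau p k).2}

open Classical in
/-- The Young symmetrizer `(∑_{σ row} σ) (∑_{τ column} sgn(τ) τ)` in the group algebra. -/
def youngSymmetrizer {n : ℕ} (p : n.Partition) : MonoidAlgebra ℂ (Equiv.Perm (Fin n)) :=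
  (∑ σ with σ ∈ rowGroup p, MonoidAlgebra.of ℂ _ σ) *
    ∑ τ with τ ∈ colGroup p, ((Equiv.Perm.sign τ : ℤ) : ℂ) • MonoidAlgebra.of ℂ _ τ

/-- The Specht module of `p`: the left ideal generated by the Young symmetrizer. With the left
multiplication by the symmetric group it is the irreducible representation indexed by `p`. -/
def spechtModule {n : ℕ} (p : n.Partition) :
    Submodule (MonoidAlgebra ℂ (Equiv.Perm (Fin n))) (MonoidAlgebra ℂ (Equiv.Perm (Fin n))) :=
  Submodule.span _ {youngSymmetrizer p}

/-- `π` is a unitary matrix representation in the equivalence class indexed by `p`. -/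
def InClass {n m : ℕ} (p : n.Partition)
    (π : Equiv.Perm (Fin n) →* Matrix.unitaryGroup (Fin m) ℂ) : Prop :=
  ∃ e : spechtModule p ≃ₗ[ℂ] (Fin m → ℂ),
    ∀ (σ : Equiv.Perm (Fin n)) (v : spechtModule p),
      e (MonoidAlgebra.of ℂ _ σ • v) = (π σ : Matrix (Fin m) (Fin m) ℂ).mulVec (e v)

/-- The operator `P^{ij} f = (m / n!) ∑_σ π(σ⁻¹)_{ji} (f ∘ σ⁻¹)`, `m` being the degree of `π`. -/
def projOp {n m : ℕ} (lam : Set.Ioi (0 : ℝ))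
    (π : Equiv.Perm (Fin n) →* Matrix.unitaryGroup (Fin m) ℂ) (i j : Fin m) :
    BergmanSpace n lam →L[ℂ] BergmanSpace n lam :=
  ((m : ℂ) / (n.factorial : ℂ)) •
    ∑ σ : Equiv.Perm (Fin n), (π σ⁻¹ : Matrix (Fin m) (Fin m) ℂ) j i • permOp lam σ

/-- The subspace `P^{ii}(A^(λ)(𝔻ⁿ))`. -/
def projSpace {n m : ℕ} (lam : Set.Ioi (0 : ℝ))
    (π : Equiv.Perm (Fin n) →* Matrix.unitaryGroup (Fin m) ℂ) (i : Fin m) :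
    Submodule ℂ (BergmanSpace n lam) :=
  LinearMap.range (projOp lam π i i).toLinearMap

/-! ### Spectral sets and the symmetrized polydisc -/

/-- The symmetrization map: the coordinate with index `k : Fin n` is the elementary symmetric
function of degree `k + 1`. -/
def symMap (n : ℕ) (z : Fin n → ℂ) (k : Fin n) : ℂ :=
  ∑ A ∈ Finset.powersetCard (k + 1) Finset.univ, ∏ j ∈ A, z j

/-- `Γ_n`, the closure of the image of the open polydisc under the symmetrization map. -/
def Gam (n : ℕ) : Set (Fin n → ℂ) :=
  closure (symMap n '' {z | ∀ i, ‖z i‖ < 1})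

/-- `q(T_1, …, T_n)` for a polynomial `q` and a commuting tuple `T`. -/
def polyEval {n : ℕ} {R : Type*} [Ring R] [Algebra ℂ R] (T : Fin n → R)
    (q : MvPolynomial (Fin n) ℂ) : R :=
  ∑ d ∈ q.support, MvPolynomial.coeff d q • (List.ofFn fun i => T i ^ d i).prod

/-- The tuple `T` of operators commutes and admits `X` as a spectral set:
`‖q(T)‖ ≤ sup_X |q|` for all polynomials `q`. -/
structure HasSpectralSet {n : ℕ} {H : Type*} [NormedAddCommGroup H] [InnerProductSpace ℂ H]
    (X : Set (Fin n → ℂ)) (T : Fin n → H →L[ℂ] H) : Prop where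
  commute : ∀ i j, Commute (T i) (T j)
  norm_le : ∀ q : MvPolynomial (Fin n) ℂ,
    ‖polyEval T q‖ ≤ sSup ((fun z => ‖MvPolynomial.eval z q‖) '' X)

/-- A `Γ_n`-contraction is a commuting tuple that admits `Γ_n` as a spectral set. -/
def IsGamContraction {n : ℕ} {H : Type*} [NormedAddCommGroup H] [InnerProductSpace ℂ H]
    (T : Fin n → H →L[ℂ] H) : Prop :=
  HasSpectralSet (Gam n) T

/-- `T` is the operator of pointwise multiplication by `φ`. -/
def IsMulOp {n : ℕ} {lam : Set.Ioi (0 : ℝ)} (φ : (Fin n → ℂ) → ℂ)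
    (T : BergmanSpace n lam →L[ℂ] BergmanSpace n lam) : Prop :=
  ∀ (f : BergmanSpace n lam) (z : Polydisc n), T f z = φ z.1 * f z

end SymBergman

end

noncomputable section


namespace SymBergman

open scoped ComplexConjugate ComplexOrder

open Filter Topology

/-! ### The truncated Szegő kernel and averages over roots of unity -/

/-! Everything rests on a von Neumann type bound: for `λ ≥ 1`, multiplication by a polynomial `P`
has norm at most any `C` dominating `|P|` on the torus. Since the adjoint sends `K(·, w)` to `conj
(P w) • K(·, w)`, this amounts to positivity of the kernel `(C² - P(z) conj P(w)) K(z, w)`.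

For `λ = 1` this is the Hardy space estimate. It is proved without integration: the kernel is
truncated, and the torus is replaced by a grid of roots of unity fine enough to integrate the
polynomials involved exactly (`truncSzego_posSemidef`). Letting the truncation grow gives
`szego_posSemidef`, and the Schur product with the positive kernel of exponent `λ - 1` gives
`kernelFun_mul_posSemidef`.

Applied to `q ∘ s`, the bound is controlled by `Γ_n`, because `s` maps the torus into `Γ_n`. Each
`s_k` is symmetric, so multiplication by it commutes with the permutation operators, hence with
`projOp`, and preserves its range. Restricting to an invariant subspace cannot increase the norm of
`q(M_s)`. -/

/-- Orthogonality of the characters of `ℤ/N`: the summands form a geometric progression of ratio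
`ω^(e-k)`, and `k, e < N` makes this ratio nontrivial unless `k = e`. -/
theorem sum_conj_pow_mul_pow {N : ℕ} {ω : ℂ} (hω : IsPrimitiveRoot ω N) (hN : 0 < N) {k e : ℕ}
    (hk : k < N) (he : e < N) :
    ∑ l : Fin N, conj (ω ^ (l : ℕ)) ^ k * (ω ^ (l : ℕ)) ^ e = if k = e then (N : ℂ) else 0 := by
  have h1 : ω * conj ω = 1 := by
    rw [Complex.mul_conj, Complex.normSq_eq_norm_sq, hω.norm'_eq_one hN.ne']
    norm_num
  have h0 : ω ≠ 0 := hω.ne_zero hN.ne'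
  have hc : conj ω = ω⁻¹ := eq_inv_of_mul_eq_one_right h1
  have hterm : ∀ l : ℕ, conj (ω ^ l) ^ k * (ω ^ l) ^ e = (ω⁻¹ ^ k * ω ^ e) ^ l := fun l => by
    rw [map_pow, hc, mul_pow, ← pow_mul, ← pow_mul, ← pow_mul, ← pow_mul, mul_comm l, mul_comm l]
  simp only [hterm]
  rw [Fin.sum_univ_eq_sum_range fun l => (ω⁻¹ ^ k * ω ^ e) ^ l]
  split_ifs with h
  · subst h
    simp [h0]
  · have hne : ω⁻¹ ^ k * ω ^ e ≠ 1 := fun h2 => h <| hω.pow_inj hk he <| by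
      rw [inv_pow] at h2
      exact (eq_of_inv_mul_eq_one h2)
    have hp : (ω⁻¹ ^ k * ω ^ e) ^ N = 1 := by
      rw [mul_pow, ← pow_mul, ← pow_mul, mul_comm k, mul_comm e, pow_mul, pow_mul, inv_pow,
        hω.pow_eq_one]
      simp
    rw [geom_sum_eq hne, hp, sub_self, zero_div]

/-- Reproducing property in one variable. The condition `d + M ≤ L` keeps the tested polynomial
within the degrees that the kernel of length `L` reproduces, and `L ≤ N` prevents aliasing on the
grid. -/
theorem sum_conj_geom_mul {N L M d : ℕ} {ω : ℂ} (hω : IsPrimitiveRoot ω N) (hN : 0 < N)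
    (hL : L ≤ N) (hd : d + M ≤ L) (z w : ℂ) :
    ∑ l : Fin N, conj (∑ k ∈ Finset.range L, (ω ^ (l : ℕ) * conj z) ^ k) *
        ((ω ^ (l : ℕ)) ^ d * ∑ k ∈ Finset.range M, (ω ^ (l : ℕ) * conj w) ^ k)
      = N * (z ^ d * ∑ k ∈ Finset.range M, (z * conj w) ^ k) := by
  have h1 : ∀ e < L, ∑ l : Fin N, conj (∑ k ∈ Finset.range L, (ω ^ (l : ℕ) * conj z) ^ k) *
      (ω ^ (l : ℕ)) ^ e = N * z ^ e := by
    intro e he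
    have : ∀ l : Fin N, conj (∑ k ∈ Finset.range L, (ω ^ (l : ℕ) * conj z) ^ k) *
        (ω ^ (l : ℕ)) ^ e = ∑ k ∈ Finset.range L,
          z ^ k * (conj (ω ^ (l : ℕ)) ^ k * (ω ^ (l : ℕ)) ^ e) := fun l => by
      rw [map_sum, Finset.sum_mul]
      refine Finset.sum_congr rfl fun k _ => ?_
      rw [map_pow, map_mul, Complex.conj_conj, mul_pow]
      ring
    simp only [this]
    rw [Finset.sum_comm]
    simp only [← Finset.mul_sum]
    rw [Finset.sum_congr rfl fun k hk => by
      rw [sum_conj_pow_mul_pow hω hN ((Finset.mem_range.1 hk).trans_le hL) (he.trans_le hL)]]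
    simp [he, mul_comm]
  have h2 : ∀ l : Fin N, conj (∑ k ∈ Finset.range L, (ω ^ (l : ℕ) * conj z) ^ k) *
        ((ω ^ (l : ℕ)) ^ d * ∑ k ∈ Finset.range M, (ω ^ (l : ℕ) * conj w) ^ k)
      = ∑ i ∈ Finset.range M, conj w ^ i *
        (conj (∑ k ∈ Finset.range L, (ω ^ (l : ℕ) * conj z) ^ k) * (ω ^ (l : ℕ)) ^ (d + i)) :=
    fun l => by
      rw [Finset.mul_sum, Finset.mul_sum]
      refine Finset.sum_congr rfl fun k _ => ?_
      ring
  simp only [h2]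
  rw [Finset.sum_comm]
  simp only [← Finset.mul_sum]
  rw [Finset.sum_congr rfl fun k hk => by
    rw [h1 (d + k) (by have := Finset.mem_range.1 hk; omega)]]
  rw [Finset.mul_sum, Finset.mul_sum]
  refine Finset.sum_congr rfl fun k _ => ?_
  ring

/-- The Szegő kernel of the polydisc, truncated to degrees less than `N` in each variable. -/
def truncSzego {n : ℕ} (N : ℕ) (z w : Fin n → ℂ) : ℂ :=
  ∏ j, ∑ k ∈ Finset.range N, (z j * conj (w j)) ^ k

theorem conj_truncSzego {n : ℕ} (N : ℕ) (z w : Fin n → ℂ) :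
    conj (truncSzego N z w) = truncSzego N w z := by
  simp [truncSzego, mul_comm]

theorem tendsto_truncSzego {n : ℕ} (z w : Polydisc n) :
    Tendsto (fun N => truncSzego N z.1 w.1) atTop (𝓝 (∏ j, (1 - z.1 j * conj (w.1 j))⁻¹)) :=
  tendsto_finsetProd _ fun j _ =>
    (hasSum_geometric_of_norm_lt_one (norm_mul_conj_lt (z.2 j) (w.2 j))).tendsto_sum_nat

/-- The points of the torus whose coordinates are powers of `ω`. -/
def rootPt {n N : ℕ} (ω : ℂ) (x : Fin n → Fin N) (j : Fin n) : ℂ := ω ^ (x j : ℕ)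

theorem sum_truncSzego_mul {n N L M : ℕ} {ω : ℂ} (hω : IsPrimitiveRoot ω N) (hN : 0 < N)
    (hL : L ≤ N) (P : MvPolynomial (Fin n) ℂ) (hd : P.totalDegree + M ≤ L) (z w : Fin n → ℂ) :
    ∑ x : Fin n → Fin N, conj (truncSzego L (rootPt ω x) z) *
        (MvPolynomial.eval (rootPt ω x) P * truncSzego M (rootPt ω x) w)
      = (N : ℂ) ^ n * (MvPolynomial.eval z P * truncSzego M z w) := by
  simp only [MvPolynomial.eval_eq', Finset.sum_mul, Finset.mul_sum]
  rw [Finset.sum_comm]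
  refine Finset.sum_congr rfl fun d hdP => ?_
  have hle : ∀ j, d j ≤ P.totalDegree := fun j =>
    (Finsupp.le_degree j d).trans (MvPolynomial.le_totalDegree hdP)
  -- For a single monomial of `P` the sum over the grid factors into one-variable sums.
  have h := Fintype.prod_sum fun (j : Fin n) (l : Fin N) =>
    conj (∑ k ∈ Finset.range L, (ω ^ (l : ℕ) * conj (z j)) ^ k) *
      ((ω ^ (l : ℕ)) ^ d j * ∑ k ∈ Finset.range M, (ω ^ (l : ℕ) * conj (w j)) ^ k)
  rw [Finset.prod_congr rfl fun j _ =>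
    sum_conj_geom_mul hω hN hL (d := d j) (M := M) (by have := hle j; omega) (z j) (w j)] at h
  simp only [Finset.prod_mul_distrib, Finset.prod_const, Finset.card_univ, Fintype.card_fin] at h
  simp only [truncSzego, rootPt]
  rw [mul_assoc (MvPolynomial.coeff d P), mul_left_comm, h, Finset.mul_sum]
  refine Finset.sum_congr rfl fun x _ => ?_
  rw [map_prod]
  ring

theorem sum_conj_sum_mul_sum {ι X : Type*} (r : Finset ι) (s : Finset X) (f g : X → ι → ℂ) :
    ∑ x ∈ r, conj (∑ a ∈ s, f a x) * ∑ b ∈ s, g b x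
      = ∑ a ∈ s, ∑ b ∈ s, ∑ x ∈ r, conj (f a x) * g b x := by
  simp only [map_sum, Finset.sum_mul_sum]
  rw [Finset.sum_comm]
  exact Finset.sum_congr rfl fun a _ => Finset.sum_comm

/-- With the grid inner product, let `F = ∑ v_b S_D(·, u_b)` and `G = ∑ v_b conj (P(u_b)) S_M(·,
u_b)`, where `S` is the truncated kernel. As `P * G` has degree below `D = deg P + M` in each
variable, `S_D` reproduces it, so `⟨F, P G⟩ = ⟨G, G⟩`. Cauchy–Schwarz gives `‖G‖² ≤ C² ‖F‖²`, which
is the claim. The two truncation lengths differ to leave room for `deg P`. -/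
theorem truncSzego_posSemidef {n : ℕ} {C : ℝ} (P : MvPolynomial (Fin n) ℂ)
    (hC : ∀ ζ : Fin n → ℂ, (∀ j, ‖ζ j‖ = 1) → ‖MvPolynomial.eval ζ P‖ ≤ C) {X : Type*}
    (u : X → Fin n → ℂ) (M : ℕ) :
    (Matrix.of fun a b => (C : ℂ) ^ 2 * truncSzego (P.totalDegree + M) (u a) (u b)
      - MvPolynomial.eval (u a) P * conj (MvPolynomial.eval (u b) P)
        * truncSzego M (u a) (u b) : Matrix X X ℂ).PosSemidef := by
  refine ⟨?_, fun v => ?_⟩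
  · ext a b
    simp [conj_truncSzego, mul_comm]
  -- The successor is taken because `deg P + M` may be zero.
  obtain ⟨N, hN, hdN⟩ : ∃ N, 0 < N ∧ P.totalDegree + M ≤ N := ⟨_, Nat.succ_pos _, Nat.le_succ _⟩
  set D := P.totalDegree + M with hD
  obtain ⟨ω, hω⟩ : ∃ ω : ℂ, IsPrimitiveRoot ω N := ⟨_, Complex.isPrimitiveRoot_exp N hN.ne'⟩
  set p : X → ℂ := fun a => MvPolynomial.eval (u a) P with hp
  set F : (Fin n → Fin N) → ℂ := fun x => ∑ b ∈ v.support, v b * truncSzego D (rootPt ω x) (u b)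
    with hF
  set G : (Fin n → Fin N) → ℂ := fun x =>
    ∑ b ∈ v.support, v b * conj (p b) * truncSzego M (rootPt ω x) (u b) with hG
  have repF : ∑ x, conj (F x) * F x = (N : ℂ) ^ n * ∑ a ∈ v.support, ∑ b ∈ v.support,
      conj (v a) * truncSzego D (u a) (u b) * v b := by
    simp only [hF, sum_conj_sum_mul_sum, map_mul]
    rw [Finset.mul_sum]
    refine Finset.sum_congr rfl fun a _ => ?_
    rw [Finset.mul_sum]
    refine Finset.sum_congr rfl fun b _ => ?_
    have h := sum_truncSzego_mul hω hN hdN (1 : MvPolynomial (Fin n) ℂ) (M := D) (by simp)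
      (u a) (u b)
    simp only [map_one, one_mul] at h
    calc _ = conj (v a) * v b * ∑ x : Fin n → Fin N, conj (truncSzego D (rootPt ω x) (u a)) *
          truncSzego D (rootPt ω x) (u b) := by
          rw [Finset.mul_sum]; exact Finset.sum_congr rfl fun x _ => by ring
      _ = _ := by rw [h]; ring
  have repG : ∑ x, conj (G x) * G x = (N : ℂ) ^ n * ∑ a ∈ v.support, ∑ b ∈ v.support,
      conj (v a) * (p a * conj (p b) * truncSzego M (u a) (u b)) * v b := by
    simp only [hG, sum_conj_sum_mul_sum, map_mul]
    rw [Finset.mul_sum]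
    refine Finset.sum_congr rfl fun a _ => ?_
    rw [Finset.mul_sum]
    refine Finset.sum_congr rfl fun b _ => ?_
    have h := sum_truncSzego_mul hω hN (show M ≤ N by omega) (1 : MvPolynomial (Fin n) ℂ)
      (M := M) (by simp) (u a) (u b)
    simp only [map_one, one_mul] at h
    calc _ = conj (v a) * p a * v b * conj (p b) *
          ∑ x : Fin n → Fin N, conj (truncSzego M (rootPt ω x) (u a)) *
          truncSzego M (rootPt ω x) (u b) := by
          rw [Finset.mul_sum]
          exact Finset.sum_congr rfl fun x _ => by rw [Complex.conj_conj]; ring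
      _ = _ := by rw [h]; ring
  have repFG : ∑ x, conj (F x) * (MvPolynomial.eval (rootPt ω x) P * G x) =
      (N : ℂ) ^ n * ∑ a ∈ v.support, ∑ b ∈ v.support,
      conj (v a) * (p a * conj (p b) * truncSzego M (u a) (u b)) * v b := by
    have hPG : ∀ x, MvPolynomial.eval (rootPt ω x) P * G x = ∑ b ∈ v.support,
        MvPolynomial.eval (rootPt ω x) P *
          (v b * conj (p b) * truncSzego M (rootPt ω x) (u b)) := fun x => Finset.mul_sum ..
    simp only [hPG]
    simp only [hF, sum_conj_sum_mul_sum, map_mul]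
    rw [Finset.mul_sum]
    refine Finset.sum_congr rfl fun a _ => ?_
    rw [Finset.mul_sum]
    refine Finset.sum_congr rfl fun b _ => ?_
    have h := sum_truncSzego_mul hω hN hdN P (M := M) le_rfl (u a) (u b)
    calc _ = conj (v a) * v b * conj (p b) *
          ∑ x : Fin n → Fin N, conj (truncSzego D (rootPt ω x) (u a)) *
          (MvPolynomial.eval (rootPt ω x) P * truncSzego M (rootPt ω x) (u b)) := by
          rw [Finset.mul_sum]
          exact Finset.sum_congr rfl fun x _ => by ring
      _ = _ := by rw [h]; ring
  have hω1 : ‖ω‖ = 1 := hω.norm'_eq_one hN.ne'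
  have hsq : ∀ f : (Fin n → Fin N) → ℂ, ∑ x, conj (f x) * f x = ((∑ x, ‖f x‖ ^ 2 : ℝ) : ℂ) := by
    intro f
    push_cast
    exact Finset.sum_congr rfl fun x _ => Complex.conj_mul' _
  have hle : ∑ x, ‖G x‖ ^ 2 ≤ C ^ 2 * ∑ x, ‖F x‖ ^ 2 := by
    have h1 : ∑ x, ‖G x‖ ^ 2 = ‖∑ x, conj (F x) * (MvPolynomial.eval (rootPt ω x) P * G x)‖ := by
      rw [repFG, ← repG, hsq, Complex.norm_of_nonneg (by positivity)]
    have h2 : ‖∑ x, conj (F x) * (MvPolynomial.eval (rootPt ω x) P * G x)‖ ≤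
        ∑ x, (C ^ 2 * ‖F x‖ ^ 2 + ‖G x‖ ^ 2) / 2 := by
      refine (norm_sum_le _ _).trans (Finset.sum_le_sum fun x _ => ?_)
      rw [norm_mul, norm_mul, RCLike.norm_conj]
      have h3 : ‖MvPolynomial.eval (rootPt ω x) P‖ ≤ C :=
        hC _ fun j => by simp [rootPt, hω1]
      have h4 := mul_le_mul_of_nonneg_left h3 (mul_nonneg (norm_nonneg (F x)) (norm_nonneg (G x)))
      -- The pointwise inequality `2 C ‖F‖ ‖G‖ ≤ C² ‖F‖² + ‖G‖²` replaces Cauchy–Schwarz; half of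
      -- `‖G‖²` is absorbed after summation.
      nlinarith [sq_nonneg (C * ‖F x‖ - ‖G x‖)]
    rw [← Finset.sum_div, Finset.sum_add_distrib, ← Finset.mul_sum, ← h1] at h2
    linarith
  have hN' : (N : ℂ) ^ n ≠ 0 := pow_ne_zero _ (by exact_mod_cast hN.ne')
  have key : (v.sum fun i xi => v.sum fun j xj => star xi * (Matrix.of fun a b => (C : ℂ) ^ 2 *
      truncSzego D (u a) (u b) - p a * conj (p b) * truncSzego M (u a) (u b) : Matrix X X ℂ) i j
        * xj) = (((C ^ 2 * ∑ x, ‖F x‖ ^ 2 - ∑ x, ‖G x‖ ^ 2) / (N : ℝ) ^ n : ℝ) : ℂ) := by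
    rw [Complex.ofReal_div, Complex.ofReal_sub, Complex.ofReal_mul, ← hsq, ← hsq, repF, repG]
    push_cast
    rw [eq_div_iff hN', mul_left_comm, ← mul_sub, mul_comm]
    congr 1
    simp only [Finsupp.sum, Finset.mul_sum, ← Finset.sum_sub_distrib]
    refine Finset.sum_congr rfl fun a _ => Finset.sum_congr rfl fun b _ => ?_
    simp only [Matrix.of_apply, RCLike.star_def]
    ring
  rw [key]
  exact_mod_cast div_nonneg (sub_nonneg.2 hle) (by positivity)

/-! ### Positivity for the Szegő kernel and its weighted analogues -/

theorem posSemidef_of_tendsto {X : Type*} {A : ℕ → Matrix X X ℂ} {B : Matrix X X ℂ}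
    (hA : ∀ k, (A k).PosSemidef) (h : ∀ x y, Tendsto (fun k => A k x y) atTop (𝓝 (B x y))) :
    B.PosSemidef := by
  refine ⟨?_, fun v => ?_⟩
  · ext x y
    rw [Matrix.conjTranspose_apply]
    refine tendsto_nhds_unique (h y x).star ?_
    simpa only [← Matrix.conjTranspose_apply, (hA _).1.eq] using h x y
  · refine ge_of_tendsto' (f := fun k => v.sum fun i xi => v.sum fun j xj =>
      star xi * A k i j * xj) (x := atTop) ?_ fun k => (hA k).2 v
    exact tendsto_finsetSum _ fun i _ => tendsto_finsetSum _ fun j _ =>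
      ((h i j).const_mul _).mul_const _

theorem szego_posSemidef {n : ℕ} {C : ℝ} (P : MvPolynomial (Fin n) ℂ)
    (hC : ∀ ζ : Fin n → ℂ, (∀ j, ‖ζ j‖ = 1) → ‖MvPolynomial.eval ζ P‖ ≤ C) :
    (Matrix.of fun z w : Polydisc n =>
      ((C : ℂ) ^ 2 - MvPolynomial.eval z.1 P * conj (MvPolynomial.eval w.1 P)) *
        ∏ j, (1 - z.1 j * conj (w.1 j))⁻¹ : Matrix _ _ ℂ).PosSemidef := by
  refine posSemidef_of_tendsto (fun M => truncSzego_posSemidef P hC (fun z : Polydisc n => z.1) M)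
    fun z w => ?_
  simp only [Matrix.of_apply, sub_mul]
  refine Tendsto.sub (Tendsto.const_mul _ ?_) ((tendsto_truncSzego z w).const_mul _)
  exact (tendsto_truncSzego z w).comp (tendsto_add_atTop_nat _ |>.congr fun k => add_comm _ _)

/-- The exponent `0`, where the kernel is constantly `1`, is needed for the factor of exponent `λ -
1` when `λ = 1`. -/
theorem kernelFun_posSemidef_of_nonneg (n : ℕ) {lam : ℝ} (h : 0 ≤ lam) :
    (kernelFun n lam).PosSemidef := by
  rcases h.eq_or_lt with rfl | h
  · have : kernelFun n 0 = Matrix.of fun _ _ => (1 : ℂ) * conj 1 := by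
      ext z w
      simp [kernelFun]
    rw [this]
    exact rankOne_posSemidef fun _ => 1
  · exact kernelFun_posSemidef n h

/-- Schur product theorem for the Szegő kernel positivity and the kernel of exponent `λ - 1`; this
is where `λ ≥ 1` enters. -/
theorem kernelFun_mul_posSemidef {n : ℕ} {lam C : ℝ} (hlam : 1 ≤ lam) (P : MvPolynomial (Fin n) ℂ)
    (hC : ∀ ζ : Fin n → ℂ, (∀ j, ‖ζ j‖ = 1) → ‖MvPolynomial.eval ζ P‖ ≤ C) :
    (Matrix.of fun z w : Polydisc n =>
      ((C : ℂ) ^ 2 - MvPolynomial.eval z.1 P * conj (MvPolynomial.eval w.1 P)) *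
        kernelFun n lam z w : Matrix _ _ ℂ).PosSemidef := by
  have h := (szego_posSemidef P hC).hadamard
    (kernelFun_posSemidef_of_nonneg n (sub_nonneg.2 hlam))
  refine (congrArg Matrix.PosSemidef (Matrix.ext fun z w => ?_)).mpr h
  simp only [Matrix.of_apply, Matrix.hadamard_apply, kernelFun]
  rw [mul_assoc, ← Finset.prod_mul_distrib]
  congr 1
  refine Finset.prod_congr rfl fun j _ => ?_
  have hne : 1 - z.1 j * conj (w.1 j) ≠ 0 := fun h0 => by
    have := norm_mul_conj_lt (z.2 j) (w.2 j)
    rw [← sub_eq_zero.1 h0] at this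
    simp at this
  rw [← Complex.cpow_neg_one, ← Complex.cpow_add _ _ hne]
  congr 1
  push_cast
  ring

/-! ### Multiplication operators -/

theorem norm_sq_kerComb_smul {n : ℕ} (lam : Set.Ioi (0 : ℝ)) (φ : Polydisc n → ℂ)
    (v : Polydisc n →₀ ℂ) :
    ((‖Finsupp.linearCombination ℂ (fun w => conj (φ w) • ker lam w) v‖ ^ 2 : ℝ) : ℂ)
      = v.sum fun a xa => v.sum fun b xb =>
        star xa * (φ a * conj (φ b) * kernelFun n lam a b) * xb := by
  rw [Finsupp.linearCombination_apply]
  push_cast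
  rw [← RCLike.ofReal_eq_complex_ofReal, ← inner_self_eq_norm_sq_to_K (𝕜 := ℂ)]
  simp only [Finsupp.sum, sum_inner, inner_sum, inner_smul_left, inner_smul_right,
    inner_ker, ker_apply]
  rw [Finset.sum_comm]
  refine Finset.sum_congr rfl fun a _ => ?_
  rw [Finset.mul_sum, Finset.mul_sum]
  refine Finset.sum_congr rfl fun b _ => ?_
  simp only [RCLike.star_def, Complex.conj_conj]
  ring

/-- Positivity says exactly that `K(·, w) ↦ conj (φ w) • K(·, w)` is bounded by `C` on combinations
of kernel functions. These are dense, and the adjoint of the extension is multiplication by `φ`. -/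
theorem exists_mulOp {n : ℕ} {lam : Set.Ioi (0 : ℝ)} {C : ℝ} (hC : 0 ≤ C) (φ : Polydisc n → ℂ)
    (h : (Matrix.of fun z w : Polydisc n => ((C : ℂ) ^ 2 - φ z * conj (φ w)) *
      kernelFun n lam z w : Matrix _ _ ℂ).PosSemidef) :
    ∃ T : BergmanSpace n lam →L[ℂ] BergmanSpace n lam,
      (∀ f z, T f z = φ z * f z) ∧ ‖T‖ ≤ C := by
  set L := Finsupp.linearCombination ℂ (fun w => conj (φ w) • ker lam w) with hL
  have hb : ∀ v, ‖L v‖ ≤ C * ‖kerComb lam v‖ := by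
    intro v
    refine le_of_sq_le_sq ?_ (by positivity)
    have h0 := h.2 v
    have h1 := norm_sq_kerComb_smul lam φ v
    have h2 := norm_sq_kerComb_smul lam (fun _ => 1) v
    simp only [map_one, one_smul, one_mul] at h2
    have h3 : (v.sum fun a xa => v.sum fun b xb => star xa *
        (Matrix.of fun z w : Polydisc n => ((C : ℂ) ^ 2 - φ z * conj (φ w)) *
          kernelFun n lam z w : Matrix _ _ ℂ) a b * xb)
        = (((C * ‖kerComb lam v‖) ^ 2 - ‖L v‖ ^ 2 : ℝ) : ℂ) := by
      rw [Complex.ofReal_sub, h1, mul_pow, Complex.ofReal_mul,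
        show kerComb lam v = Finsupp.linearCombination ℂ (fun w => ker lam w) v from rfl, h2]
      simp only [Finsupp.sum, Finset.mul_sum, ← Finset.sum_sub_distrib]
      refine Finset.sum_congr rfl fun a _ => Finset.sum_congr rfl fun b _ => ?_
      simp only [Matrix.of_apply, RCLike.star_def]
      push_cast
      ring
    rw [h3] at h0
    have h4 : 0 ≤ (C * ‖kerComb lam v‖) ^ 2 - ‖L v‖ ^ 2 := by exact_mod_cast h0
    linarith
  refine ⟨(L.extendOfNorm (kerComb lam)).adjoint, fun f z => ?_, ?_⟩
  · have he := LinearMap.extendOfNorm_eq (kerComb_dense lam) ⟨C, hb⟩ (Finsupp.single z 1)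
    have he' : L.extendOfNorm (kerComb lam) (ker lam z) = conj (φ z) • ker lam z := by
      simpa [kerComb, hL] using he
    rw [← inner_ker z, ContinuousLinearMap.adjoint_inner_right, he', inner_smul_left,
      Complex.conj_conj, inner_ker]
  · rw [LinearIsometryEquiv.norm_map]
    exact LinearMap.opNorm_extendOfNorm_le (kerComb_dense lam) hC hb

/-- Multiplication by a polynomial has norm at most its maximum modulus on the torus. -/
theorem exists_mulOp_eval {n : ℕ} {lam : Set.Ioi (0 : ℝ)} (hlam : 1 ≤ (lam : ℝ)) {C : ℝ}
    (hC0 : 0 ≤ C) (P : MvPolynomial (Fin n) ℂ)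
    (hC : ∀ ζ : Fin n → ℂ, (∀ j, ‖ζ j‖ = 1) → ‖MvPolynomial.eval ζ P‖ ≤ C) :
    ∃ T : BergmanSpace n lam →L[ℂ] BergmanSpace n lam,
      (∀ (f : BergmanSpace n lam) (z : Polydisc n), T f z = MvPolynomial.eval z.1 P * f z) ∧
        ‖T‖ ≤ C :=
  exists_mulOp hC0 (fun z => MvPolynomial.eval z.1 P) (kernelFun_mul_posSemidef hlam P hC)

/-! ### The symmetrized polydisc -/

theorem eval_esymm {n : ℕ} (z : Fin n → ℂ) (k : Fin n) :
    MvPolynomial.eval z (MvPolynomial.esymm (Fin n) ℂ (k + 1)) = symMap n z k := by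
  simp [MvPolynomial.esymm, symMap]

theorem continuous_symMap (n : ℕ) : Continuous (symMap n) := by
  refine continuous_pi fun k => ?_
  simp only [← eval_esymm]
  exact MvPolynomial.continuous_eval _

theorem symMap_comp_perm {n : ℕ} (σ : Equiv.Perm (Fin n)) (z : Fin n → ℂ) :
    symMap n (fun i => z (σ i)) = symMap n z := by
  funext k
  rw [← eval_esymm, ← eval_esymm]
  conv_rhs => rw [← MvPolynomial.rename_esymm (Fin n) ℂ (k + 1) σ, MvPolynomial.eval_rename]
  rfl

theorem isCompact_Gam (n : ℕ) : IsCompact (Gam n) := by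
  have hK : IsCompact (symMap n '' Set.univ.pi fun _ => Metric.closedBall (0 : ℂ) 1) :=
    (isCompact_univ_pi fun _ => isCompact_closedBall _ _).image (continuous_symMap n)
  refine hK.of_isClosed_subset isClosed_closure (closure_minimal ?_ hK.isClosed)
  refine Set.image_mono fun z hz i _ => ?_
  simpa using (hz i).le

/-- Approach `ζ` radially by `r ζ` with `r` increasing to `1`. -/
theorem symMap_mem_Gam {n : ℕ} {ζ : Fin n → ℂ} (hζ : ∀ j, ‖ζ j‖ = 1) : symMap n ζ ∈ Gam n := by
  have h1 : Tendsto (fun r : ℝ => symMap n ((r : ℂ) • ζ)) (𝓝[<] 1) (𝓝 (symMap n ζ)) := by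
    have hc : Continuous fun r : ℝ => symMap n ((r : ℂ) • ζ) :=
      (continuous_symMap n).comp (Complex.continuous_ofReal.smul continuous_const)
    simpa using (hc.tendsto 1).mono_left nhdsWithin_le_nhds
  refine mem_closure_of_tendsto h1 ?_
  filter_upwards [Ioo_mem_nhdsLT (zero_lt_one' ℝ)] with r hr
  refine ⟨_, fun i => ?_, rfl⟩
  simpa [hζ, abs_of_pos hr.1] using hr.2

theorem exists_mulOp_eval_symMap {n : ℕ} {lam : Set.Ioi (0 : ℝ)} (hlam : 1 ≤ (lam : ℝ))
    (q : MvPolynomial (Fin n) ℂ) :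
    ∃ T : BergmanSpace n lam →L[ℂ] BergmanSpace n lam,
      IsMulOp (fun z => MvPolynomial.eval (symMap n z) q) T ∧
        ‖T‖ ≤ sSup ((fun u => ‖MvPolynomial.eval u q‖) '' Gam n) := by
  set P : MvPolynomial (Fin n) ℂ :=
    MvPolynomial.bind₁ (fun k : Fin n => MvPolynomial.esymm (Fin n) ℂ (k + 1)) q with hP
  have he : ∀ z, MvPolynomial.eval z P = MvPolynomial.eval (symMap n z) q := fun z => by
    rw [hP, MvPolynomial.eval, MvPolynomial.eval₂Hom_bind₁]
    simp only [← MvPolynomial.eval.eq_1, eval_esymm]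
  obtain ⟨T, hT, hn⟩ := exists_mulOp_eval hlam
    (C := sSup ((fun u => ‖MvPolynomial.eval u q‖) '' Gam n))
    (Real.sSup_nonneg (by rintro _ ⟨u, _, rfl⟩; positivity)) P fun ζ hζ => by
      rw [he]
      -- Compactness of `Γ_n` makes the real supremum a genuine upper bound rather than a default
      -- value.
      exact le_csSup ((isCompact_Gam n).image
        (MvPolynomial.continuous_eval q).norm).bddAbove ⟨_, symMap_mem_Gam hζ, rfl⟩
  exact ⟨T, fun f z => by rw [hT, he], hn⟩

/-! ### Functional calculus and restriction -/

theorem IsMulOp.pow {n : ℕ} {lam : Set.Ioi (0 : ℝ)} {φ : (Fin n → ℂ) → ℂ}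
    {T : BergmanSpace n lam →L[ℂ] BergmanSpace n lam} (h : IsMulOp φ T) (k : ℕ) :
    IsMulOp (fun z => φ z ^ k) (T ^ k) := by
  induction k with
  | zero => intro f z; simp
  | succ k ih =>
    intro f z
    change (T ^ (k + 1)) f z = φ z.1 ^ (k + 1) * f z
    rw [pow_succ', mul_apply_eq_comp, h, ih f z, pow_succ', mul_assoc]

theorem isMulOp_list_prod {n : ℕ} {lam : Set.Ioi (0 : ℝ)} {r : ℕ} {φ : Fin r → (Fin n → ℂ) → ℂ}
    {T : Fin r → BergmanSpace n lam →L[ℂ] BergmanSpace n lam} (h : ∀ i, IsMulOp (φ i) (T i)) :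
    IsMulOp (fun z => ∏ i, φ i z) (List.ofFn T).prod := by
  induction r with
  | zero => intro f z; simp
  | succ r ih =>
    intro f z
    change (List.ofFn T).prod f z = (∏ i, φ i z.1) * f z
    rw [List.ofFn_succ, List.prod_cons, mul_apply_eq_comp, h 0,
      ih (fun i => h i.succ) f z, Fin.prod_univ_succ, mul_assoc]

theorem sum_coe_apply {n : ℕ} {lam : Set.Ioi (0 : ℝ)} {ι : Type*} (s : Finset ι)
    (f : ι → BergmanSpace n lam) (z : Polydisc n) : (∑ i ∈ s, f i) z = ∑ i ∈ s, f i z := by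
  simp only [← inner_ker, inner_sum]

theorem isMulOp_polyEval {n : ℕ} {lam : Set.Ioi (0 : ℝ)} {φ : (Fin n → ℂ) → Fin n → ℂ}
    {T : Fin n → BergmanSpace n lam →L[ℂ] BergmanSpace n lam}
    (h : ∀ k, IsMulOp (fun z => φ z k) (T k)) (q : MvPolynomial (Fin n) ℂ) :
    IsMulOp (fun z => MvPolynomial.eval (φ z) q) (polyEval T q) := by
  intro f z
  change polyEval T q f z = MvPolynomial.eval (φ z.1) q * f z
  rw [polyEval, sum_apply, sum_coe_apply, MvPolynomial.eval_eq',
    Finset.sum_mul]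
  refine Finset.sum_congr rfl fun d _ => ?_
  rw [smul_apply, RKHS.coe_smul, Pi.smul_apply,
    isMulOp_list_prod (fun i => (h i).pow (d i)) f z, smul_eq_mul, mul_assoc]

theorem IsMulOp.unique {n : ℕ} {lam : Set.Ioi (0 : ℝ)} {φ : (Fin n → ℂ) → ℂ}
    {S T : BergmanSpace n lam →L[ℂ] BergmanSpace n lam} (hS : IsMulOp φ S) (hT : IsMulOp φ T) :
    S = T := by
  ext f z
  rw [hS, hT]

/-- Restriction to an invariant subspace commutes with the polynomial calculus, so norm bounds pass
down to the subspace. -/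
theorem coe_polyEval_restrict {n : ℕ} {H : Type*} [NormedAddCommGroup H] [InnerProductSpace ℂ H]
    {p : Submodule ℂ H} {M : Fin n → H →L[ℂ] H} (hM : ∀ k, ∀ f ∈ p, M k f ∈ p)
    (q : MvPolynomial (Fin n) ℂ) (f : p) :
    (polyEval (fun k => (M k).restrict (hM k)) q f : H) = polyEval M q f := by
  have hpow : ∀ k r (g : p), (((M k).restrict (hM k) ^ r) g : H) = (M k ^ r) g := by
    intro k r
    induction r with
    | zero => intro g; simp
    | succ r ih =>
      intro g
      rw [pow_succ, pow_succ, mul_apply_eq_comp, mul_apply_eq_comp, ih]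
      rfl
  have hprod : ∀ (r : ℕ) (A : Fin r → p →L[ℂ] p) (B : Fin r → H →L[ℂ] H),
      (∀ i g, (A i g : H) = B i g) → ∀ g, ((List.ofFn A).prod g : H) = (List.ofFn B).prod g := by
    intro r
    induction r with
    | zero => intro A B _ g; simp
    | succ r ih =>
      intro A B hAB g
      rw [List.ofFn_succ, List.ofFn_succ, List.prod_cons, List.prod_cons,
        mul_apply_eq_comp, mul_apply_eq_comp, hAB,
        ih _ _ fun i => hAB i.succ]
  simp only [polyEval, sum_apply, smul_apply,
    Submodule.coe_sum, Submodule.coe_smul]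
  exact Finset.sum_congr rfl fun d _ => by rw [hprod _ _ _ fun i => hpow i (d i)]

theorem IsMulOp.projOp_comm {n m : ℕ} {lam : Set.Ioi (0 : ℝ)} {φ : (Fin n → ℂ) → ℂ}
    {T : BergmanSpace n lam →L[ℂ] BergmanSpace n lam} (h : IsMulOp φ T)
    (hφ : ∀ (σ : Equiv.Perm (Fin n)) z, φ (fun i => z (σ i)) = φ z)
    (π : Equiv.Perm (Fin n) →* Matrix.unitaryGroup (Fin m) ℂ) (i j : Fin m)
    (f : BergmanSpace n lam) : T (projOp lam π i j f) = projOp lam π i j (T f) := by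
  have hperm : ∀ σ, T (permOp lam σ f) = permOp lam σ (T f) := fun σ => by
    ext z
    rw [h, permOp_apply, permOp_apply, h]
    exact congrArg (· * _) (hφ σ z.1).symm
  simp only [projOp, smul_apply, sum_apply, map_smul,
    map_sum, hperm]

end SymBergman

end

theorem theorem3p9 (n : ℕ) (lam : Set.Ioi (0 : ℝ)) (hlam : 1 ≤ (lam : ℝ))
    (p : n.Partition) (m : ℕ) (π : Equiv.Perm (Fin n) →* Matrix.unitaryGroup (Fin m) ℂ)
    (hπ : SymBergman.InClass p π) (i : Fin m) :
    ∃ M : Fin n → SymBergman.BergmanSpace n lam →L[ℂ] SymBergman.BergmanSpace n lam,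
      (∀ k, SymBergman.IsMulOp (fun z => SymBergman.symMap n z k) (M k)) ∧
      ∃ hM : ∀ k, ∀ f ∈ SymBergman.projSpace lam π i, M k f ∈ SymBergman.projSpace lam π i,
        SymBergman.IsGamContraction (fun k => (M k).restrict (hM k)) := by
  choose S hS hSn using SymBergman.exists_mulOp_eval_symMap (n := n) hlam
  have hX : ∀ k, SymBergman.IsMulOp (fun z => SymBergman.symMap n z k)
      (S (MvPolynomial.X k)) := fun k => by
    simpa using hS (MvPolynomial.X k)
  refine ⟨fun k => S (MvPolynomial.X k), hX, ?_, ?_, ?_⟩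
  · rintro k _ ⟨g, rfl⟩
    exact ⟨S (MvPolynomial.X k) g, ((hX k).projOp_comm
      (fun σ z => by rw [SymBergman.symMap_comp_perm]) π i i g).symm⟩
  · intro k l
    ext f z
    change S (MvPolynomial.X k) (S (MvPolynomial.X l) f) z
      = S (MvPolynomial.X l) (S (MvPolynomial.X k) f) z
    rw [hX, hX, hX, hX]
    ring
  · intro q
    refine ContinuousLinearMap.opNorm_le_bound _
      (Real.sSup_nonneg (by rintro _ ⟨u, _, rfl⟩; positivity)) fun f => ?_
    -- Both `q(M_s)` and `S q` multiply by `q ∘ s`, hence coincide, and the bound for `S q` applies.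
    rw [Submodule.coe_norm, Submodule.coe_norm, SymBergman.coe_polyEval_restrict,
      (SymBergman.isMulOp_polyEval hX q).unique (hS q)]
    exact (S q).le_of_opNorm_le (hSn q) _
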